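/- Let $q$ be an indeterminate, $[n]=\frac{q^n-q^{-n}}{q-q^{-1}}$ for $n\in\mathbb{Z}$, $[n]!=[n][n-1]\cdots[1]$, $[0]!=1$, and $\left[{n\atop r}\right]=\frac{[n]!}{[n-r]!\,[r]!}$ for $0\le r\le n$. Let $\hat U_q$ be the (unital, associative) $\mathbb{C}(q)$-algebra with generators $x_n,y_n$ $(n\in\mathbb{Z})$, $h_k$ $(k\in\mathbb{Z}\setminus\{0\})$, $K^{\pm1}$, $c^{\pm1/2}$ and defining relations $$KK^{-1}=K^{-1}K=1,\quad c^{1/2}c^{-1/2}=c^{-1/2}c^{1/2}=1,\quad c^{1/2}\text{ is central},$$ $$[h_m,h_n]=\delta_{m,-n}\frac{[2m]}{m}\frac{c^m-c^{-m}}{q-q^{-1}},\quad Kh_m=h_mK,\quad Kx_mK^{-1}=q^2x_m,\quad Ky_mK^{-1}=q^{-2}y_m,$$ $$[h_m,x_n]=\frac{[2m]}{m}c^{-|m|/2}x_{m+n},\quad [h_m,y_n]=-\frac{[2m]}{m}c^{|m|/2}y_{m+n},$$ $$x_{m+1}x_n-q^2x_nx_{m+1}=q^2x_mx_{n+1}-x_{n+1}x_m,\quad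 y_{m+1}y_n-q^{-2}y_ny_{m+1}=q^{-2}y_my_{n+1}-y_{n+1}y_m,$$ $$[x_m,y_n]=\frac{c^{(m-n)/2}\psi_{m+n}-c^{-(m-n)/2}\phi_{m+n}}{q-q^{-1}},$$ where $\psi_{-m}=\phi_m=0$ for $m>0$, $\sum_{m\ge0}\psi_mz^{-m}=K\exp\big((q-q^{-1})\sum_{m\ge1}h_mz^{-m}\big)$ and $\sum_{m\ge0}\phi_{-m}z^{m}=K^{-1}\exp\big(-(q-q^{-1})\sum_{m\ge1}h_{-m}z^{m}\big)$ (the Drinfeld realization of the quantum affine algebra $U_q(\hat{\mathfrak{sl}}_2)$). Put $$X_0^+(z)=\sum_{k\ge0}x_kz^{-k},\qquad Y_0^+(z)=\sum_{k\ge0}y_kz^{-k}\qquad\text{in }\hat U_q[[z^{-1}]].$$ For integers $0\le m_n\le\dots\le m_1$ let $l_1,\dots,l_j$ be the multiplicities of the distinct values occurring in $(m_n,\dots,m_1)$, and put $$c_{m_n,\dots,m_1}(q)=\frac{[n]!}{[l_1]!\cdots[l_j]!}\,q^{\sum_{i=1}^n2(i-1)m_i+\left(n(n-1)-\sum_{i=1}^jl_i(l_i-1)\right)/2}.$$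 Then, for every integer $n\ge1$, $$X_0^+(z)^n=\sum_{0\le m_n\le\dots\le m_1}c_{m_n,\dots,m_1}(q)\,x_{m_n}\cdots x_{m_1}\,z^{-(m_1+\dots+m_n)},$$ $$Y_0^+(z)^n=\sum_{0\le m_n\le\dots\le m_1}c_{m_n,\dots,m_1}(q)\,y_{m_1}\cdots y_{m_n}\,z^{-(m_1+\dots+m_n)},$$ and for all $0\le m_n\le\dots\le m_1$ the coefficient $c_{m_n,\dots,m_1}(q)$ lies in $\mathbb{Z}[q,q^{-1}]$ and equals $d_{m_n,\dots,m_1}(q)$, where $d$ is defined recursively by $d=1$ for the empty tuple and, for $k\ge1$, $$d_{m_k,\dots,m_1}(q)=q^{k(k-1)m_k}\sum_{j=0}^{k-1}(-1)^{k+j+1}\left[{k\atop j}\right]q^{(k-j)(k-1)-j(j-1)m_k}\,d_{m_j,\dots,m_1}(q)\,\delta_{m_{j+1},m_k}.$$ -/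

import Mathlib

namespace QuantumAffine

noncomputable section

/-- The base field `ℂ(q)` of rational functions in the indeterminate `q`. -/
abbrev Cq : Type := RatFunc ℂ

/-- The indeterminate `q`. -/
def q : Cq := RatFunc.X

/-- The `q`-integer `[n] = (q^n - q^{-n}) / (q - q^{-1})`. -/
def qInt (n : ℤ) : Cq := (q ^ n - q ^ (-n)) / (q - q⁻¹)

/-- The `q`-factorial `[n]! = [n][n-1]⋯[1]`, with `[0]! = 1`. -/
def qFactorial (n : ℕ) : Cq := ∏ i ∈ Finset.range n, qInt ((i : ℤ) + 1)

/-- The `q`-binomial coefficient `[n]! / ([n-r]! [r]!)`, used for `r ≤ n` only. -/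
def qBinom (n r : ℕ) : Cq := qFactorial n / (qFactorial (n - r) * qFactorial r)

/-- The generators `x_n`, `y_n` (`n ∈ ℤ`), `h_k` (`k ∈ ℤ ∖ {0}`), `K^{±1}`, `c^{±1/2}`. -/
inductive Gen : Type
  | x (n : ℤ)
  | y (n : ℤ)
  | h (k : {k : ℤ // k ≠ 0})
  | K
  | Kinv
  | cHalf
  | cHalfInv

/-- The free algebra on the generators. -/
abbrev Free : Type := FreeAlgebra Cq Gen

namespace Free

/-- The generator `x_n`. -/
def x (n : ℤ) : Free := FreeAlgebra.ι Cq (Gen.x n)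

/-- The generator `y_n`. -/
def y (n : ℤ) : Free := FreeAlgebra.ι Cq (Gen.y n)

/-- The generator `h_k`, `k ≠ 0`. -/
def h (k : {k : ℤ // k ≠ 0}) : Free := FreeAlgebra.ι Cq (Gen.h k)

/-- The generator `K`. -/
def K : Free := FreeAlgebra.ι Cq Gen.K

/-- The generator `K^{-1}`. -/
def Kinv : Free := FreeAlgebra.ι Cq Gen.Kinv

/-- The generator `c^{1/2}`. -/
def cHalf : Free := FreeAlgebra.ι Cq Gen.cHalf

/-- The generator `c^{-1/2}`. -/
def cHalfInv : Free := FreeAlgebra.ι Cq Gen.cHalfInv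

/-- The power `c^{e/2} = (c^{1/2})^e`, `e ∈ ℤ`. -/
def cPow (e : ℤ) : Free := if 0 ≤ e then cHalf ^ e.toNat else cHalfInv ^ (-e).toNat

/-- The exponential `∑_k S^k / k!` of a power series `S` without constant term; the coefficient of
degree `m` receives contributions from `k ≤ m` only. -/
def expSeries (S : PowerSeries Free) : PowerSeries Free :=
  PowerSeries.mk fun m =>
    PowerSeries.coeff m (∑ k ∈ Finset.range (m + 1), ((k.factorial : Cq)⁻¹) • S ^ k)

/-- The series `(q - q^{-1}) ∑_{m ≥ 1} h_m z^{-m}`, as a power series in `z^{-1}`. -/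
def hPlus : PowerSeries Free :=
  PowerSeries.mk fun m => if hm : (m : ℤ) ≠ 0 then (q - q⁻¹) • h ⟨m, hm⟩ else 0

/-- The series `-(q - q^{-1}) ∑_{m ≥ 1} h_{-m} z^m`, as a power series in `z`. -/
def hMinus : PowerSeries Free :=
  PowerSeries.mk fun m =>
    if hm : -(m : ℤ) ≠ 0 then (-(q - q⁻¹)) • h ⟨-(m : ℤ), hm⟩ else 0

/-- The elements `ψ_m`, with `∑_{m ≥ 0} ψ_m z^{-m} = K exp((q - q^{-1}) ∑_{m ≥ 1} h_m z^{-m})`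
and `ψ_m = 0` for `m < 0`. -/
def psi (m : ℤ) : Free :=
  if 0 ≤ m then K * PowerSeries.coeff m.toNat (expSeries hPlus) else 0

/-- The elements `φ_m`, with
`∑_{m ≥ 0} φ_{-m} z^m = K^{-1} exp(-(q - q^{-1}) ∑_{m ≥ 1} h_{-m} z^m)`
and `φ_m = 0` for `m > 0`. -/
def phi (m : ℤ) : Free :=
  if m ≤ 0 then Kinv * PowerSeries.coeff (-m).toNat (expSeries hMinus) else 0

end Free

open Free in
/-- The defining relations of the Drinfeld realization of the quantum affine algebra of `sl_2`. -/
inductive Rel : Free → Free → Prop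
  | K_Kinv : Rel (K * Kinv) 1
  | Kinv_K : Rel (Kinv * K) 1
  | c_cinv : Rel (cHalf * cHalfInv) 1
  | cinv_c : Rel (cHalfInv * cHalf) 1
  | c_central (g : Gen) : Rel (cHalf * FreeAlgebra.ι Cq g) (FreeAlgebra.ι Cq g * cHalf)
  | h_h (m n : {k : ℤ // k ≠ 0}) :
      Rel (h m * h n - h n * h m)
        (if (m : ℤ) = -(n : ℤ) then
          (qInt (2 * (m : ℤ)) / ((m : ℤ) : Cq) / (q - q⁻¹)) • (cPow (2 * m) - cPow (-(2 * m)))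
        else 0)
  | K_h (m : {k : ℤ // k ≠ 0}) : Rel (K * h m) (h m * K)
  | K_x (m : ℤ) : Rel (K * x m * Kinv) (q ^ (2 : ℤ) • x m)
  | K_y (m : ℤ) : Rel (K * y m * Kinv) (q ^ (-2 : ℤ) • y m)
  | h_x (m : {k : ℤ // k ≠ 0}) (n : ℤ) :
      Rel (h m * x n - x n * h m)
        ((qInt (2 * (m : ℤ)) / ((m : ℤ) : Cq)) • (cPow (-|(m : ℤ)|) * x (m + n)))
  | h_y (m : {k : ℤ // k ≠ 0}) (n : ℤ) :
      Rel (h m * y n - y n * h m)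
        (-((qInt (2 * (m : ℤ)) / ((m : ℤ) : Cq)) • (cPow |(m : ℤ)| * y (m + n))))
  | x_x (m n : ℤ) :
      Rel (x (m + 1) * x n - q ^ (2 : ℤ) • (x n * x (m + 1)))
        (q ^ (2 : ℤ) • (x m * x (n + 1)) - x (n + 1) * x m)
  | y_y (m n : ℤ) :
      Rel (y (m + 1) * y n - q ^ (-2 : ℤ) • (y n * y (m + 1)))
        (q ^ (-2 : ℤ) • (y m * y (n + 1)) - y (n + 1) * y m)
  | x_y (m n : ℤ) :
      Rel (x m * y n - y n * x m)
        ((q - q⁻¹)⁻¹ • (cPow (m - n) * psi (m + n) - cPow (-(m - n)) * phi (m + n)))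

/-- The `ℂ(q)`-algebra `Û_q` given by the generators and relations above. -/
def Uq : Type := RingQuot Rel

instance : Ring Uq := inferInstanceAs (Ring (RingQuot Rel))

instance : Algebra Cq Uq := inferInstanceAs (Algebra Cq (RingQuot Rel))

/-- The quotient map from the free algebra onto `Û_q`. -/
def toUq : Free →ₐ[Cq] Uq := RingQuot.mkAlgHom Cq Rel

/-- The generator `x_n` of `Û_q`. -/
def x (n : ℤ) : Uq := toUq (Free.x n)

/-- The generator `y_n` of `Û_q`. -/
def y (n : ℤ) : Uq := toUq (Free.y n)

/-- The generating function `X_0^+(z) = ∑_{k ≥ 0} x_k z^{-k}`, an element of `Û_q[[z^{-1}]]`: the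
variable of the power series is `z^{-1}`. -/
def X0plus : PowerSeries Uq := PowerSeries.mk fun k => x (k : ℤ)

/-- The generating function `Y_0^+(z) = ∑_{k ≥ 0} y_k z^{-k}`, an element of `Û_q[[z^{-1}]]`: the
variable of the power series is `z^{-1}`. -/
def Y0plus : PowerSeries Uq := PowerSeries.mk fun k => y (k : ℤ)

/-! A tuple `0 ≤ m_n ≤ ⋯ ≤ m_1` is an antitone function `m : Fin n → ℕ`; the entry `m_i` is the
value of `m` at the `i`-th element of `Fin n`, whose underlying number is `i - 1`. -/

open scoped Classical in
/-- The finite set of the tuples `0 ≤ m_n ≤ ⋯ ≤ m_1` with `m_1 + ⋯ + m_n = N`. -/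
def orderedTuples (n N : ℕ) : Finset (Fin n → ℕ) :=
  (Finset.Nat.antidiagonalTuple n N).filter fun m => Antitone m

/-- The number of occurrences of the value `v` in the tuple `m`. -/
def mult {n : ℕ} (m : Fin n → ℕ) (v : ℕ) : ℕ := (Finset.univ.filter fun i => m i = v).card

/-- The ordered monomial `x_{m_n} ⋯ x_{m_1}`. -/
def xMonomial {n : ℕ} (m : Fin n → ℕ) : Uq := ((List.ofFn fun i => x (m i : ℤ)).reverse).prod

/-- The ordered monomial `y_{m_1} ⋯ y_{m_n}`. -/
def yMonomial {n : ℕ} (m : Fin n → ℕ) : Uq := (List.ofFn fun i => y (m i : ℤ)).prod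

/-- The coefficient
`[n]! / ([l_1]! ⋯ [l_j]!) * q ^ (∑_i 2(i-1)m_i + (n(n-1) - ∑_i l_i(l_i-1)) / 2)`, where
`l_1, …, l_j` are the multiplicities of the distinct values of `m`. The division by `2` is exact,
because every `l(l-1)` is even. -/
def pbwCoeff {n : ℕ} (m : Fin n → ℕ) : Cq :=
  qFactorial n / (∏ v ∈ Finset.univ.image m, qFactorial (mult m v)) *
    q ^ ((∑ i : Fin n, 2 * ((i : ℕ) : ℤ) * (m i : ℤ)) +
      ((n : ℤ) * ((n : ℤ) - 1) -
        ∑ v ∈ Finset.univ.image m, (mult m v : ℤ) * ((mult m v : ℤ) - 1)) / 2)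

/-- The recursively defined coefficients: the value is `1` for the empty tuple, and for `k ≥ 1` the
value at `(m_k, …, m_1)` is
`q^{k(k-1)m_k} ∑_{j=0}^{k-1} (-1)^{k+j+1} [k choose j] q^{(k-j)(k-1) - j(j-1)m_k}`
times the value at `(m_j, …, m_1)` times the Kronecker delta of `m_{j+1}` and `m_k`.
Here `k` is written as `k' + 1`. -/
def recCoeff : (k : ℕ) → (Fin k → ℕ) → Cq
  | 0, _ => 1
  | k' + 1, m =>
    q ^ (((k' : ℤ) + 1) * (k' : ℤ) * (m (Fin.last k') : ℤ)) *
      ∑ j : Fin (k' + 1),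
        (-1) ^ (k' + 1 + (j : ℕ) + 1) * qBinom (k' + 1) (j : ℕ) *
          q ^ (((k' : ℤ) + 1 - ((j : ℕ) : ℤ)) * (k' : ℤ) -
            ((j : ℕ) : ℤ) * (((j : ℕ) : ℤ) - 1) * (m (Fin.last k') : ℤ)) *
          recCoeff (j : ℕ) (fun i => m (Fin.castLE j.isLt.le i)) *
          (if m j = m (Fin.last k') then 1 else 0)
termination_by k => k
decreasing_by exact j.isLt

end

end QuantumAffine

/-!
Write `u = z⁻¹`, `X = ∑ x_k u^k` and `X' = ∑ x_{k+1} u^k`, so that `X = x_0 + u X'`. Adding up the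
quadratic relations `x_{m+1} x_n + x_{n+1} x_m = q² (x_m x_{n+1} + x_n x_{m+1})` over `m + n = N`
counts every product twice and gives `X' X = q² X X'` (`mk_shift_mul_mk`). Thus `Z = u X'` satisfies
`Z (x_0 + Z) = q² (x_0 + Z) Z`, and a noncommutative binomial theorem (`add_pow_of_qCommute`) yields
`X^n = ∑_s G(n, s) q^{s(s-1)} x_0^{n-s} u^s X'^s`, where `G` is the Gaussian binomial coefficient in
`q²`. The shifted sequence `x_{k+1}` satisfies the same relations, so strong induction on the degree
in `u` applies to `X'^s` (`coeff_mk_pow`). The closed formula for the coefficients obeys the same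
recursion: removing the `n - s` zeros from an ordered tuple and lowering the other entries by one
divides the coefficient by `G(n, s) q^{s(s-1)}` (`pbwCoeff_split`, `pbwCoeff_add_one`). The formula
for the `y_k` is the same statement in the opposite algebra.

Removing the block of smallest entries from a tuple also shows, by induction, that the coefficients
are Laurent polynomials, because the `q`-binomial coefficients are. For the comparison with the
recursive coefficients, the Kronecker delta confines the sum to this block, and the recursion becomes
the vanishing of `∑_i (-1)^i q^{i(i-1)} G(p, i)` for `p ≥ 1` (`sum_neg_one_pow_mul_gaussBinom`).
-/

namespace QuantumAffine

noncomputable section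

open PowerSeries

/-! ### `q`-integers and `q`-factorials -/

lemma q_ne_zero : q ≠ 0 := RatFunc.X_ne_zero

lemma q_pow_ne_one {n : ℕ} (hn : n ≠ 0) : q ^ n ≠ 1 := by
  intro h
  have h1 : (Polynomial.X ^ n : Polynomial ℂ) = 1 := by
    apply RatFunc.algebraMap_injective ℂ
    simpa [q, RatFunc.algebraMap_X] using h
  have h2 := congrArg Polynomial.natDegree h1
  simp at h2
  exact hn h2

lemma q_sub_inv_ne_zero : q - q⁻¹ ≠ 0 := by
  intro h
  apply q_pow_ne_one two_ne_zero
  have h1 : q = q⁻¹ := sub_eq_zero.mp h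
  calc q ^ 2 = q * q := sq q
    _ = q * q⁻¹ := by rw [← h1]
    _ = 1 := mul_inv_cancel₀ q_ne_zero

lemma qInt_succ_ne_zero (n : ℕ) : qInt ((n : ℤ) + 1) ≠ 0 := by
  unfold qInt
  refine div_ne_zero ?_ q_sub_inv_ne_zero
  intro h
  apply q_pow_ne_one (n := 2 * (n + 1)) (by omega)
  have h1 : q ^ ((n : ℤ) + 1) = q ^ (-((n : ℤ) + 1)) := sub_eq_zero.mp h
  calc q ^ (2 * (n + 1)) = q ^ ((n : ℤ) + 1) * q ^ ((n : ℤ) + 1) := by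
        rw [← zpow_add₀ q_ne_zero, ← zpow_natCast]; congr 1; push_cast; ring
    _ = q ^ (-((n : ℤ) + 1)) * q ^ ((n : ℤ) + 1) := by rw [← h1]
    _ = 1 := by rw [← zpow_add₀ q_ne_zero]; simp

lemma qFactorial_ne_zero (n : ℕ) : qFactorial n ≠ 0 :=
  Finset.prod_ne_zero_iff.mpr fun i _ => qInt_succ_ne_zero i

lemma qFactorial_zero : qFactorial 0 = 1 := by simp [qFactorial]

lemma qFactorial_succ (n : ℕ) : qFactorial (n + 1) = qFactorial n * qInt ((n : ℤ) + 1) := by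
  simp [qFactorial, Finset.prod_range_succ]

/-- The addition rule behind the `q`-Pascal recursion. -/
lemma qInt_add (a b : ℤ) : qInt (a + b) = q ^ (-b) * qInt a + q ^ a * qInt b := by
  unfold qInt
  rw [mul_div_assoc', mul_div_assoc', ← add_div]
  congr 1
  simp only [mul_sub, ← zpow_add₀ q_ne_zero]
  rw [show -b + a = a - b by ring, show -b + -a = -(a + b) by ring,
    show a + -b = a - b by ring]
  ring

/-! ### Gaussian binomial coefficients -/

/-- The Gaussian binomial coefficients in the variable `q ^ 2`, by their Pascal recursion. They are
polynomials in `q ^ 2`, and vanish for `r > n`. -/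
def gaussBinom : ℕ → ℕ → Cq
  | _, 0 => 1
  | 0, _ + 1 => 0
  | n + 1, r + 1 => gaussBinom n r + q ^ (2 * ((r : ℤ) + 1)) * gaussBinom n (r + 1)

lemma gaussBinom_zero_right (n : ℕ) : gaussBinom n 0 = 1 := by
  cases n <;> simp [gaussBinom]

lemma gaussBinom_succ_succ (n r : ℕ) : gaussBinom (n + 1) (r + 1) =
    gaussBinom n r + q ^ (2 * ((r : ℤ) + 1)) * gaussBinom n (r + 1) := by
  rw [gaussBinom]

lemma gaussBinom_eq_zero_of_lt {n r : ℕ} (h : n < r) : gaussBinom n r = 0 := by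
  induction n generalizing r with
  | zero => obtain ⟨r, rfl⟩ := Nat.exists_eq_succ_of_ne_zero h.ne'; simp [gaussBinom]
  | succ n ih =>
    obtain ⟨r, rfl⟩ := Nat.exists_eq_succ_of_ne_zero (Nat.ne_of_gt (Nat.zero_lt_of_lt h))
    rw [Nat.succ_eq_add_one, gaussBinom_succ_succ, ih (by omega), ih (by omega)]
    simp

lemma gaussBinom_self (n : ℕ) : gaussBinom n n = 1 := by
  induction n with
  | zero => exact gaussBinom_zero_right 0
  | succ n ih => rw [gaussBinom_succ_succ, ih, gaussBinom_eq_zero_of_lt (Nat.lt_succ_self n)]; simp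

lemma gaussBinom_mul_qFactorial (s p : ℕ) :
    gaussBinom (s + p) s * (qFactorial p * qFactorial s) =
      q ^ ((s : ℤ) * p) * qFactorial (s + p) := by
  induction s generalizing p with
  | zero => simp [gaussBinom_zero_right, qFactorial_zero]
  | succ s ihs =>
    induction p with
    | zero => simp [gaussBinom_self, qFactorial_zero]
    | succ p ihp =>
      have h1 := ihs (p + 1)
      rw [show s + 1 + p = s + (p + 1) by ring] at ihp
      rw [show s + 1 + (p + 1) = (s + (p + 1)) + 1 by ring, gaussBinom_succ_succ]
      have h2 : qInt (((s + (p + 1) : ℕ) : ℤ) + 1) =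
          q ^ (-((p : ℤ) + 1)) * qInt ((s : ℤ) + 1) + q ^ ((s : ℤ) + 1) * qInt ((p : ℤ) + 1) := by
        rw [← qInt_add]; congr 1; push_cast; ring
      have e1 : q ^ (((s + 1 : ℕ) : ℤ) * ((p + 1 : ℕ) : ℤ)) * q ^ (-((p : ℤ) + 1)) =
          q ^ ((s : ℤ) * ((p + 1 : ℕ) : ℤ)) := by
        rw [← zpow_add₀ q_ne_zero]; congr 1; push_cast; ring
      have e2 : q ^ (((s + 1 : ℕ) : ℤ) * ((p + 1 : ℕ) : ℤ)) * q ^ ((s : ℤ) + 1) =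
          q ^ (2 * ((s : ℤ) + 1)) * q ^ (((s + 1 : ℕ) : ℤ) * (p : ℤ)) := by
        rw [← zpow_add₀ q_ne_zero, ← zpow_add₀ q_ne_zero]; congr 1; push_cast; ring
      rw [qFactorial_succ (s + (p + 1)), h2]
      calc _ = qInt ((s : ℤ) + 1) * (gaussBinom (s + (p + 1)) s *
              (qFactorial (p + 1) * qFactorial s)) +
            q ^ (2 * ((s : ℤ) + 1)) * qInt ((p : ℤ) + 1) * (gaussBinom (s + (p + 1)) (s + 1) *
              (qFactorial p * qFactorial (s + 1))) := by
            rw [qFactorial_succ s, qFactorial_succ p]; ring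
        _ = _ := by
            rw [h1, ihp, ← e1]
            linear_combination (-qFactorial (s + (p + 1)) * qInt ((p : ℤ) + 1)) * e2

/-- The Gaussian binomial coefficient is the symmetric one up to a power of `q`. -/
lemma gaussBinom_eq_qBinom (s p : ℕ) :
    gaussBinom (s + p) s = q ^ ((s : ℤ) * p) * qBinom (s + p) s := by
  have h := gaussBinom_mul_qFactorial s p
  have h1 := qFactorial_ne_zero s
  have h2 := qFactorial_ne_zero p
  rw [qBinom, Nat.add_sub_cancel_left, mul_div_assoc', eq_div_iff (mul_ne_zero h2 h1), h]

/-- The vanishing case of the `q`-binomial theorem, `∏_{i < p + 1} (1 - q^{2i}) = 0`: by the Pascal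
recursion the sum telescopes. -/
lemma sum_neg_one_pow_mul_gaussBinom (p : ℕ) :
    ∑ i ∈ Finset.range (p + 2),
      (-1) ^ i * q ^ ((i : ℤ) * (i - 1)) * gaussBinom (p + 1) i = 0 := by
  -- Partial sums in closed form; the last one has the factor `gaussBinom p (p + 1) = 0`.
  have key : ∀ M : ℕ, ∑ i ∈ Finset.range (M + 1),
      (-1) ^ i * q ^ ((i : ℤ) * (i - 1)) * gaussBinom (p + 1) i =
        (-1) ^ M * q ^ ((M : ℤ) * (M + 1)) * gaussBinom p M := by
    intro M
    induction M with
    | zero => simp [gaussBinom_zero_right]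
    | succ M ih =>
      rw [Finset.sum_range_succ, ih, gaussBinom_succ_succ]
      have e1 : q ^ (((M + 1 : ℕ) : ℤ) * (((M + 1 : ℕ) : ℤ) - 1)) = q ^ ((M : ℤ) * (M + 1)) := by
        congr 1; push_cast; ring
      have e2 : q ^ (((M + 1 : ℕ) : ℤ) * (((M + 1 : ℕ) : ℤ) + 1)) =
          q ^ ((M : ℤ) * (M + 1)) * q ^ (2 * ((M : ℤ) + 1)) := by
        rw [← zpow_add₀ q_ne_zero]; congr 1; push_cast; ring
      rw [e1, e2]
      ring
  rw [key (p + 1), gaussBinom_eq_zero_of_lt (Nat.lt_succ_self p), mul_zero]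

lemma q_zpow_mem_adjoin (e : ℤ) : q ^ e ∈ Algebra.adjoin ℤ ({q, q⁻¹} : Set Cq) := by
  cases e with
  | ofNat n =>
    rw [Int.ofNat_eq_natCast, zpow_natCast]
    exact pow_mem (Algebra.subset_adjoin (by simp)) n
  | negSucc n =>
    rw [zpow_negSucc, ← inv_pow]
    exact pow_mem (Algebra.subset_adjoin (by simp)) (n + 1)

lemma gaussBinom_mem_adjoin (n r : ℕ) :
    gaussBinom n r ∈ Algebra.adjoin ℤ ({q, q⁻¹} : Set Cq) := by
  induction n generalizing r with
  | zero => cases r <;> simp [gaussBinom, one_mem, zero_mem]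
  | succ n ih =>
    cases r with
    | zero => rw [gaussBinom_zero_right]; exact one_mem _
    | succ r =>
      rw [gaussBinom_succ_succ]
      exact add_mem (ih _) (mul_mem (q_zpow_mem_adjoin _) (ih _))

lemma qBinom_mem_adjoin (s p : ℕ) :
    qBinom (s + p) s ∈ Algebra.adjoin ℤ ({q, q⁻¹} : Set Cq) := by
  have h : qBinom (s + p) s = q ^ (-((s : ℤ) * p)) * gaussBinom (s + p) s := by
    rw [gaussBinom_eq_qBinom, ← mul_assoc, ← zpow_add₀ q_ne_zero]
    simp
  rw [h]
  exact mul_mem (q_zpow_mem_adjoin _) (gaussBinom_mem_adjoin _ _)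

/-- The noncommutative binomial theorem for elements with `z (a + z) = q² (a + z) z`. -/
lemma add_pow_of_qCommute {B : Type*} [Ring B] [Algebra Cq B] (a z : B)
    (h : z * (a + z) = q ^ (2 : ℤ) • ((a + z) * z)) (n : ℕ) :
    (a + z) ^ n = ∑ s ∈ Finset.range (n + 1),
      (gaussBinom n s * q ^ ((s : ℤ) * (s - 1))) • (a ^ (n - s) * z ^ s) := by
  have hpow : ∀ s : ℕ, z ^ s * (a + z) = q ^ (2 * (s : ℤ)) • ((a + z) * z ^ s) := by
    intro s
    induction s with
    | zero => simp
    | succ s ih =>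
      rw [pow_succ, mul_assoc, h, mul_smul_comm, ← mul_assoc, ih, smul_mul_assoc, smul_smul,
        ← zpow_add₀ q_ne_zero, mul_assoc]
      congr 2; push_cast; ring
  induction n with
  | zero => simp [gaussBinom_zero_right]
  | succ n ih =>
    have step : ∀ s ∈ Finset.range (n + 1),
        ((gaussBinom n s * q ^ ((s : ℤ) * (s - 1))) • (a ^ (n - s) * z ^ s)) * (a + z) =
          (gaussBinom n s * q ^ ((s : ℤ) * (s + 1))) • (a ^ (n + 1 - s) * z ^ s) +
          (gaussBinom n s * q ^ ((s : ℤ) * (s + 1))) • (a ^ (n - s) * z ^ (s + 1)) := by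
      intro s hs
      have hs' : s ≤ n := Nat.lt_succ_iff.mp (Finset.mem_range.mp hs)
      rw [smul_mul_assoc, mul_assoc, hpow, mul_smul_comm, smul_smul, mul_assoc,
        ← zpow_add₀ q_ne_zero, show (s : ℤ) * (s - 1) + 2 * s = s * (s + 1) by ring,
        ← smul_add, Nat.succ_sub hs', pow_succ, add_mul,
        mul_add (a ^ (n - s)), pow_succ' z, mul_assoc]
    rw [pow_succ, ih, Finset.sum_mul, Finset.sum_congr rfl step, Finset.sum_add_distrib,
      Finset.sum_range_succ' _ (n + 1)]
    have hlast : ∑ s ∈ Finset.range (n + 1),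
        (gaussBinom n s * q ^ ((s : ℤ) * (s + 1))) • (a ^ (n + 1 - s) * z ^ s) =
        ∑ s ∈ Finset.range (n + 1),
          (gaussBinom n (s + 1) * q ^ (((s + 1 : ℕ) : ℤ) * ((s + 1 : ℕ) + 1))) •
            (a ^ (n - s) * z ^ (s + 1)) + a ^ (n + 1) := by
      have := Finset.sum_range_succ (fun s : ℕ =>
        (gaussBinom n s * q ^ ((s : ℤ) * (s + 1))) • (a ^ (n + 1 - s) * z ^ s)) (n + 1)
      rw [gaussBinom_eq_zero_of_lt (Nat.lt_succ_self n), zero_mul, zero_smul, add_zero] at this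
      rw [← this, Finset.sum_range_succ']
      simp [gaussBinom_zero_right]
    rw [hlast, add_right_comm, ← Finset.sum_add_distrib]
    congr 1
    · refine Finset.sum_congr rfl fun s _ => ?_
      rw [← add_smul, Nat.add_sub_add_right, gaussBinom_succ_succ]
      congr 1
      rw [show ((s + 1 : ℕ) : ℤ) * ((s + 1 : ℕ) + 1) = 2 * ((s : ℤ) + 1) + s * (s + 1) by
          push_cast; ring,
        show ((s + 1 : ℕ) : ℤ) * ((s + 1 : ℕ) - 1) = (s : ℤ) * (s + 1) by push_cast; ring,
        zpow_add₀ q_ne_zero]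
      ring
    · simp [gaussBinom_zero_right]

/-! ### The coefficients of the ordered monomials -/

/-- Values that do not occur in `m` contribute `[0]! = 1`, so the product may be taken over any
larger set of values. -/
lemma prod_qFactorial_mult_of_subset {n : ℕ} (m : Fin n → ℕ) {T : Finset ℕ}
    (hT : Finset.univ.image m ⊆ T) :
    ∏ v ∈ Finset.univ.image m, qFactorial (mult m v) = ∏ v ∈ T, qFactorial (mult m v) := by
  refine Finset.prod_subset hT fun v _ hv => ?_
  rw [show mult m v = 0 from Finset.card_eq_zero.mpr (Finset.filter_eq_empty_iff.mpr
    fun i _ hi => hv (Finset.mem_image.mpr ⟨i, Finset.mem_univ i, hi⟩)), qFactorial_zero]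

lemma sum_mult_of_subset {n : ℕ} (m : Fin n → ℕ) {T : Finset ℕ}
    (hT : Finset.univ.image m ⊆ T) :
    ∑ v ∈ Finset.univ.image m, (mult m v : ℤ) * ((mult m v : ℤ) - 1) =
      ∑ v ∈ T, (mult m v : ℤ) * ((mult m v : ℤ) - 1) := by
  refine Finset.sum_subset hT fun v _ hv => ?_
  rw [show mult m v = 0 from Finset.card_eq_zero.mpr (Finset.filter_eq_empty_iff.mpr
    fun i _ hi => hv (Finset.mem_image.mpr ⟨i, Finset.mem_univ i, hi⟩))]
  simp

lemma mult_eq_sum {n : ℕ} (m : Fin n → ℕ) (v : ℕ) :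
    mult m v = ∑ i, if m i = v then 1 else 0 := by
  rw [mult, Finset.card_filter]

lemma sum_two_mul_fin (n : ℕ) : ∑ i : Fin n, 2 * ((i : ℕ) : ℤ) = n * ((n : ℤ) - 1) := by
  induction n with
  | zero => simp
  | succ n ih =>
    rw [Fin.sum_univ_castSucc]
    simp only [Fin.val_castSucc, ih, Fin.val_last]
    push_cast; ring

/-- Splitting off a final constant block of length `p` of value `v`, where `v` does not occur in
the first `s` entries. -/
lemma pbwCoeff_split {s p : ℕ} (m : Fin (s + p) → ℕ) (v : ℕ)
    (h1 : ∀ i : Fin s, m (Fin.castAdd p i) ≠ v) (h2 : ∀ i : Fin p, m (Fin.natAdd s i) = v) :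
    pbwCoeff m = qBinom (s + p) s *
      q ^ ((v : ℤ) * (((s : ℤ) + p) * ((s : ℤ) + p - 1) - s * ((s : ℤ) - 1)) + s * p) *
        pbwCoeff (fun i : Fin s => m (Fin.castAdd p i)) := by
  set m' : Fin s → ℕ := fun i => m (Fin.castAdd p i) with hm'
  have hmult : ∀ w, mult m w = mult m' w + if w = v then p else 0 := by
    intro w
    rw [mult_eq_sum, mult_eq_sum, Fin.sum_univ_add]
    congr 1
    simp only [h2, eq_comm (a := v)]
    split_ifs <;> simp
  have hv : v ∉ Finset.univ.image m' := by
    simp only [Finset.mem_image, Finset.mem_univ, true_and, not_exists]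
    exact h1
  have hv0 : mult m' v = 0 := Finset.card_eq_zero.mpr (Finset.filter_eq_empty_iff.mpr
    fun i _ hi => h1 i hi)
  have hsub : Finset.univ.image m ⊆ insert v (Finset.univ.image m') := by
    intro w hw
    obtain ⟨i, -, rfl⟩ := Finset.mem_image.mp hw
    refine Fin.addCases (fun i => ?_) (fun i => ?_) i
    · exact Finset.mem_insert_of_mem (Finset.mem_image.mpr ⟨i, Finset.mem_univ i, rfl⟩)
    · rw [h2]; exact Finset.mem_insert_self _ _
  have hne : ∀ w ∈ Finset.univ.image m', mult m w = mult m' w := by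
    intro w hw
    rw [hmult, if_neg (fun h : w = v => hv (h ▸ hw)), add_zero]
  have hvm : mult m v = p := by rw [hmult, hv0]; simp
  have hprod : ∏ w ∈ Finset.univ.image m, qFactorial (mult m w) =
      qFactorial p * ∏ w ∈ Finset.univ.image m', qFactorial (mult m' w) := by
    rw [prod_qFactorial_mult_of_subset m hsub, Finset.prod_insert hv, hvm]
    congr 1
    exact Finset.prod_congr rfl fun w hw => by rw [hne w hw]
  have hsum : ∑ w ∈ Finset.univ.image m, (mult m w : ℤ) * ((mult m w : ℤ) - 1) =
      p * ((p : ℤ) - 1) +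
        ∑ w ∈ Finset.univ.image m', (mult m' w : ℤ) * ((mult m' w : ℤ) - 1) := by
    rw [sum_mult_of_subset m hsub, Finset.sum_insert hv, hvm]
    congr 1
    exact Finset.sum_congr rfl fun w hw => by rw [hne w hw]
  have hlin : ∑ i : Fin (s + p), 2 * ((i : ℕ) : ℤ) * (m i : ℤ) =
      (∑ i : Fin s, 2 * ((i : ℕ) : ℤ) * (m' i : ℤ)) +
        v * (((s : ℤ) + p) * ((s : ℤ) + p - 1) - s * ((s : ℤ) - 1)) := by
    have h3 := sum_two_mul_fin (s + p)
    rw [Fin.sum_univ_add] at h3 ⊢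
    simp only [Fin.val_castAdd, sum_two_mul_fin s, h2, ← Finset.sum_mul] at h3 ⊢
    push_cast at h3 ⊢
    rw [← h3]
    simp only [hm']
    ring
  unfold pbwCoeff
  rw [hprod, hsum, hlin]
  set A := ∑ i : Fin s, 2 * ((i : ℕ) : ℤ) * (m' i : ℤ)
  set S := ∑ w ∈ Finset.univ.image m', (mult m' w : ℤ) * ((mult m' w : ℤ) - 1)
  set P := ∏ w ∈ Finset.univ.image m', qFactorial (mult m' w) with hP
  have hP0 : P ≠ 0 := Finset.prod_ne_zero_iff.mpr fun w _ => qFactorial_ne_zero _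
  -- The numerators differ by `2sp`, so no parity argument is needed for the integer division.
  have hdiv : (((s + p : ℕ) : ℤ) * (((s + p : ℕ) : ℤ) - 1) - (p * ((p : ℤ) - 1) + S)) / 2 =
      (s * ((s : ℤ) - 1) - S) / 2 + s * p := by
    rw [← Int.add_mul_ediv_right _ _ (by norm_num : (2 : ℤ) ≠ 0)]
    congr 1; push_cast; ring
  have hfac : qFactorial (s + p) / (qFactorial p * P) =
      qBinom (s + p) s * (qFactorial s / P) := by
    have := qFactorial_ne_zero s
    have := qFactorial_ne_zero p
    rw [qBinom, Nat.add_sub_cancel_left]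
    field_simp
  rw [hdiv, hfac, mul_assoc, mul_assoc]
  congr 1
  rw [mul_left_comm (q ^ _), ← zpow_add₀ q_ne_zero]
  congr 2
  ring

lemma pbwCoeff_add_one {n : ℕ} (m : Fin n → ℕ) :
    pbwCoeff (fun i => m i + 1) = q ^ ((n : ℤ) * (n - 1)) * pbwCoeff m := by
  have himg : Finset.univ.image (fun i => m i + 1) = (Finset.univ.image m).image (· + 1) := by
    rw [Finset.image_image]; rfl
  have hmult : ∀ v, mult (fun i => m i + 1) (v + 1) = mult m v := by
    intro v; simp [mult]
  have hinj : Set.InjOn (· + 1) ((Finset.univ.image m : Finset ℕ) : Set ℕ) :=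
    fun a _ b _ h => Nat.succ_injective h
  unfold pbwCoeff
  have hlin : ∑ i : Fin n, 2 * ((i : ℕ) : ℤ) * ((m i + 1 : ℕ) : ℤ) =
      (n : ℤ) * (n - 1) + ∑ i : Fin n, 2 * ((i : ℕ) : ℤ) * (m i : ℤ) := by
    rw [← sum_two_mul_fin n, ← Finset.sum_add_distrib]
    refine Finset.sum_congr rfl fun i _ => ?_
    push_cast; ring
  rw [himg, Finset.prod_image hinj, Finset.sum_image hinj, hlin, add_assoc,
    zpow_add₀ q_ne_zero ((n : ℤ) * (n - 1))]
  simp only [hmult]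
  ring

/-- The entries exceeding a given bound form an initial segment of an ordered tuple. -/
lemma exists_lt_iff_of_antitone {n : ℕ} {m : Fin n → ℕ} (hm : Antitone m) (v : ℕ) :
    ∃ s ≤ n, ∀ i : Fin n, v < m i ↔ (i : ℕ) < s := by
  classical
  have hex : ∃ s : ℕ, ∀ i : Fin n, s ≤ i → m i ≤ v :=
    ⟨n, fun i hi => absurd i.isLt (not_lt.mpr hi)⟩
  refine ⟨Nat.find hex, Nat.find_min' hex fun i hi => absurd i.isLt (not_lt.mpr hi),
    fun i => ⟨fun h => ?_, fun h => ?_⟩⟩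
  · by_contra hlt
    exact absurd h (not_lt.mpr (Nat.find_spec hex i (not_lt.mp hlt)))
  · have := Nat.find_min hex h
    push Not at this
    obtain ⟨j, hij, hj⟩ := this
    exact hj.trans_le (hm (Fin.le_def.mpr hij))

/-- The occurrences of the smallest value `m_{n+1}` form a nonempty final block, of length
`p + 1`, of an ordered tuple of length `n + 1`. -/
lemma exists_last_block {n : ℕ} {m : Fin (n + 1) → ℕ} (hm : Antitone m) :
    ∃ s p : ℕ, n = s + p ∧ ∀ i : Fin (n + 1), m i = m (Fin.last n) ↔ s ≤ (i : ℕ) := by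
  obtain ⟨s, -, hs⟩ := exists_lt_iff_of_antitone hm (m (Fin.last n))
  have hle : s ≤ n := by
    have := (hs (Fin.last n)).not.mp (lt_irrefl _)
    simpa using this
  obtain ⟨p, rfl⟩ := Nat.exists_eq_add_of_le hle
  refine ⟨s, p, rfl, fun i => ?_⟩
  have h1 := hs i
  have h2 := hm (Fin.le_last i)
  omega

lemma pbwCoeff_mem_adjoin (n : ℕ) (m : Fin n → ℕ) (hm : Antitone m) :
    pbwCoeff m ∈ Algebra.adjoin ℤ ({q, q⁻¹} : Set Cq) := by
  induction n using Nat.strong_induction_on with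
  | _ n ih =>
    cases n with
    | zero => simp [pbwCoeff, qFactorial_zero, one_mem]
    | succ n =>
      obtain ⟨s, p, rfl, hs⟩ := exists_last_block hm
      rw [pbwCoeff_split (s := s) (p := p + 1) m (m (Fin.last _))
        (fun i h => by have := (hs _).mp h; simp at this; omega)
        (fun i => (hs _).mpr (by simp))]
      exact mul_mem (mul_mem (qBinom_mem_adjoin _ _) (q_zpow_mem_adjoin _))
        (ih s (by omega) _ fun i j hij => hm hij)

/-- With `k = s + p + 1`, the alternating sum of the products `[k choose j] [j choose s]` over
`s ≤ j ≤ k` vanishes; here the term `j = k` stands on the left. By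
`[k choose j] [j choose s] = [k choose s] [k - s choose j - s]` this is
`sum_neg_one_pow_mul_gaussBinom`. -/
lemma sum_qBinom_mul_qBinom (s p : ℕ) :
    qBinom (s + (p + 1)) s * q ^ ((s : ℤ) * (p + 1)) =
      ∑ i ∈ Finset.range (p + 1), (-1) ^ (p + i) * qBinom (s + (p + 1)) (s + i) *
        qBinom (s + i) s * q ^ (((p : ℤ) + 1 - i) * (s + p) + s * i) := by
  have h0 := sum_neg_one_pow_mul_gaussBinom p
  rw [← Finset.sum_range_reflect, Finset.sum_range_succ] at h0
  have hterm : ∀ i ∈ Finset.range (p + 1),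
      (-1) ^ (p + i) * qBinom (s + (p + 1)) (s + i) *
        qBinom (s + i) s * q ^ (((p : ℤ) + 1 - i) * (s + p) + s * i) =
      -(qBinom (s + (p + 1)) s * q ^ ((s : ℤ) * (p + 1))) *
       ((-1) ^ (p + 2 - 1 - i) * q ^ (((p + 2 - 1 - i : ℕ) : ℤ) * (((p + 2 - 1 - i : ℕ) : ℤ) - 1)) *
        gaussBinom (p + 1) (p + 2 - 1 - i)) := by
    intro i hi
    obtain ⟨r, hr⟩ := Nat.exists_eq_add_of_le (Nat.lt_succ_iff.mp (Finset.mem_range.mp hi))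
    subst hr
    rw [show i + r + 2 - 1 - i = r + 1 by omega]
    have hb : qBinom (s + (i + r + 1)) (s + i) * qBinom (s + i) s =
        qBinom (s + (i + r + 1)) s * qBinom ((r + 1) + i) (r + 1) := by
      have := qFactorial_ne_zero s
      have := qFactorial_ne_zero i
      have := qFactorial_ne_zero (s + i)
      have := qFactorial_ne_zero (r + 1)
      have := qFactorial_ne_zero (i + r + 1)
      simp only [qBinom]
      rw [show s + (i + r + 1) - (s + i) = r + 1 by omega, show s + i - s = i by omega,
        show s + (i + r + 1) - s = i + r + 1 by omega, show r + 1 + i - (r + 1) = i by omega,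
        show r + 1 + i = i + r + 1 by omega]
      field_simp
    rw [mul_assoc ((-1) ^ (i + r + i)), hb]
    rw [show i + r + 1 = (r + 1) + i by ring, gaussBinom_eq_qBinom]
    have hsgn : ((-1 : Cq)) ^ (i + r + i) = -(-1) ^ (r + 1) := by
      rw [show i + r + i = 2 * i + r by ring, pow_add, pow_mul]; simp [pow_succ]
    have he : q ^ ((((i + r : ℕ) : ℤ) + 1 - i) * (s + ((i + r : ℕ) : ℤ)) + s * i) =
        q ^ ((s : ℤ) * (((i + r : ℕ) : ℤ) + 1)) *
          (q ^ (((r + 1 : ℕ) : ℤ) * (((r + 1 : ℕ) : ℤ) - 1)) * q ^ (((r + 1 : ℕ) : ℤ) * i)) := by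
      rw [← zpow_add₀ q_ne_zero, ← zpow_add₀ q_ne_zero]
      congr 1; push_cast; ring
    rw [hsgn, he]
    ring
  rw [Finset.sum_congr rfl hterm, ← Finset.mul_sum]
  have : p + 2 - 1 - (p + 1) = 0 := by omega
  rw [this] at h0
  simp only [pow_zero, Nat.cast_zero, zero_mul, zpow_zero, gaussBinom_zero_right, mul_one] at h0
  rw [eq_neg_of_add_eq_zero_left h0]
  ring

/-- The Kronecker delta restricts the recursion to the `j` in the final block of the smallest
value; splitting off the rest of that block by `pbwCoeff_split` reduces the recursion to
`sum_qBinom_mul_qBinom`. -/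
lemma recCoeff_eq_pbwCoeff (n : ℕ) (m : Fin n → ℕ) (hm : Antitone m) :
    recCoeff n m = pbwCoeff m := by
  induction n using Nat.strong_induction_on with
  | _ n ih =>
    cases n with
    | zero => rw [recCoeff]; simp [pbwCoeff, qFactorial_zero]
    | succ n =>
      obtain ⟨s, p, rfl, hs⟩ := exists_last_block hm
      rw [recCoeff]
      set v := m (Fin.last (s + p)) with hv
      rw [pbwCoeff_split (s := s) (p := p + 1) m v
        (fun i h => by have := (hs _).mp h; simp at this; omega)
        (fun i => (hs _).mpr (by simp))]
      have hzero : ∀ i : Fin s, m (Fin.castAdd (p + 1) i) ≠ v := by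
        intro i h; have := (hs _).mp h; simp at this; omega
      set C := pbwCoeff (fun i : Fin s => m (Fin.castAdd (p + 1) i)) with hC
      have hsum := Fin.sum_univ_add (a := s) (b := p + 1) (fun j : Fin (s + (p + 1)) =>
        (-1) ^ (s + p + 1 + (j : ℕ) + 1) * qBinom (s + p + 1) (j : ℕ) *
          q ^ ((((s + p : ℕ) : ℤ) + 1 - ((j : ℕ) : ℤ)) * ((s + p : ℕ) : ℤ) -
            ((j : ℕ) : ℤ) * (((j : ℕ) : ℤ) - 1) * (v : ℤ)) *
          recCoeff (j : ℕ) (fun i => m (Fin.castLE j.isLt.le i)) *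
          (if m j = v then 1 else 0))
      refine (congrArg _ hsum).trans ?_
      rw [Finset.sum_eq_zero (fun i _ => by rw [if_neg (hzero i), mul_zero]), zero_add]
      have hterm : ∀ i : Fin (p + 1),
          (-1) ^ (s + p + 1 + (Fin.natAdd s i : ℕ) + 1) * qBinom (s + p + 1) (Fin.natAdd s i : ℕ) *
          q ^ ((((s + p : ℕ) : ℤ) + 1 - ((Fin.natAdd s i : ℕ) : ℤ)) * ((s + p : ℕ) : ℤ) -
            ((Fin.natAdd s i : ℕ) : ℤ) * (((Fin.natAdd s i : ℕ) : ℤ) - 1) * (v : ℤ)) *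
          recCoeff (Fin.natAdd s i : ℕ)
            (fun k => m (Fin.castLE (Fin.natAdd s i).isLt.le k)) *
          (if m (Fin.natAdd s i) = v then 1 else 0) =
          ((-1) ^ (p + (i : ℕ)) * qBinom (s + (p + 1)) (s + i) *
            qBinom (s + i) s * q ^ (((p : ℤ) + 1 - (i : ℕ)) * (s + p) + s * (i : ℕ))) *
            (q ^ (-(v : ℤ) * (s * ((s : ℤ) - 1))) * C) := by
        intro i
        have hi := i.isLt
        have hd : recCoeff (s + (i : ℕ))
            (fun k => m (Fin.castLE (Fin.natAdd s i).isLt.le k)) =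
            qBinom (s + (i : ℕ)) s * q ^ ((v : ℤ) * (((s : ℤ) + (i : ℕ)) *
              ((s : ℤ) + (i : ℕ) - 1) - s * ((s : ℤ) - 1)) + s * (i : ℕ)) * C :=
          (ih (s + i) (by omega) (fun k => m (Fin.castLE (Fin.natAdd s i).isLt.le k))
          fun a b hab => hm hab).trans (pbwCoeff_split (s := s) (p := (i : ℕ))
            (fun k => m (Fin.castLE (Fin.natAdd s i).isLt.le k)) v
            (fun k => hzero k) (fun k => (hs _).mpr (by simp)))
        rw [if_pos ((hs _).mpr (by simp)), mul_one]
        refine (congrArg _ hd).trans ?_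
        rw [Fin.val_natAdd]
        have hsgn : (-1 : Cq) ^ (s + p + 1 + (s + (i : ℕ)) + 1) = (-1) ^ (p + (i : ℕ)) := by
          rw [show s + p + 1 + (s + (i : ℕ)) + 1 = 2 * (s + 1) + (p + i) by ring, pow_add, pow_mul]
          simp
        have he : q ^ (((p : ℤ) + 1 - (i : ℕ)) * (s + p) + s * (i : ℕ)) *
            q ^ (-(v : ℤ) * (s * ((s : ℤ) - 1))) =
            q ^ ((((s + p : ℕ) : ℤ) + 1 - ((s + i : ℕ) : ℤ)) * ((s + p : ℕ) : ℤ) -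
              ((s + i : ℕ) : ℤ) * (((s + i : ℕ) : ℤ) - 1) * (v : ℤ)) *
            q ^ ((v : ℤ) * (((s : ℤ) + (i : ℕ)) * ((s : ℤ) + (i : ℕ) - 1) - s * ((s : ℤ) - 1)) +
              s * (i : ℕ)) := by
          rw [← zpow_add₀ q_ne_zero, ← zpow_add₀ q_ne_zero]
          congr 1; push_cast; ring
        rw [hsgn]
        refine Eq.trans ?_ (congrArg (fun t => (-1) ^ (p + (i : ℕ)) *
          qBinom (s + (p + 1)) (s + i) * qBinom (s + i) s * t * C) he.symm |>.trans (by ring))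
        rw [show s + (p + 1) = s + p + 1 from rfl]
        ring
      rw [Finset.sum_congr rfl fun i _ => hterm i, ← Finset.sum_mul]
      rw [Fin.sum_univ_eq_sum_range (fun i => (-1) ^ (p + i) * qBinom (s + (p + 1)) (s + i) *
            qBinom (s + i) s * q ^ (((p : ℤ) + 1 - i) * (s + p) + s * i)) (p + 1),
        ← sum_qBinom_mul_qBinom]
      have he : q ^ ((((s + p : ℕ) : ℤ) + 1) * ((s + p : ℕ) : ℤ) * (v : ℤ)) *
          (q ^ ((s : ℤ) * (p + 1)) * q ^ (-(v : ℤ) * (s * ((s : ℤ) - 1)))) =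
          q ^ ((v : ℤ) * (((s : ℤ) + ((p + 1 : ℕ) : ℤ)) * ((s : ℤ) + ((p + 1 : ℕ) : ℤ) - 1) -
            s * ((s : ℤ) - 1)) + s * ((p + 1 : ℕ) : ℤ)) := by
        rw [← zpow_add₀ q_ne_zero, ← zpow_add₀ q_ne_zero]
        congr 1; push_cast; ring
      rw [← he]
      ring

/-! ### Ordered tuples with a given number of nonzero entries -/

/-- The number of nonzero entries of a tuple. -/
def numPos {n : ℕ} (m : Fin n → ℕ) : ℕ := (Finset.univ.filter fun i => 0 < m i).card

lemma numPos_le {n : ℕ} (m : Fin n → ℕ) : numPos m ≤ n :=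
  (Finset.card_filter_le _ _).trans (by simp)

lemma pos_iff_lt_numPos {n : ℕ} {m : Fin n → ℕ} (hm : Antitone m) (i : Fin n) :
    0 < m i ↔ (i : ℕ) < numPos m := by
  obtain ⟨s, hsn, hs⟩ := exists_lt_iff_of_antitone hm 0
  have : numPos m = s := by
    simp only [numPos, hs]
    rw [Fin.card_filter_val_lt, min_eq_right hsn]
  rw [hs, this]

lemma mem_orderedTuples {n N : ℕ} {m : Fin n → ℕ} :
    m ∈ orderedTuples n N ↔ ∑ i, m i = N ∧ Antitone m := by
  rw [orderedTuples, Finset.mem_filter, Finset.Nat.mem_antidiagonalTuple]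

lemma numPos_append {s r : ℕ} (m : Fin s → ℕ) :
    numPos (Fin.append (fun i => m i + 1) (fun _ : Fin r => 0)) = s := by
  rw [numPos, Finset.card_filter, Fin.sum_univ_add]
  simp

lemma antitone_append {s r : ℕ} {m : Fin s → ℕ} (hm : Antitone m) :
    Antitone (Fin.append (fun i => m i + 1) (fun _ : Fin r => 0)) := by
  intro i j
  refine Fin.addCases (fun i => ?_) (fun i => ?_) i <;>
    refine Fin.addCases (fun j => ?_) (fun j => ?_) j <;> intro hij
  · simp only [Fin.append_left]
    have : i ≤ j := hij
    exact Nat.succ_le_succ (hm this)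
  · simp
  · have := j.isLt
    have h2 : s + (i : ℕ) ≤ j := hij
    omega
  · simp

/-- Lowering the nonzero entries by one identifies the ordered tuples with exactly `s` nonzero
entries with the ordered tuples of length `s`. -/
lemma sum_orderedTuples_numPos {M : Type*} [AddCommMonoid M] (s r N : ℕ)
    (F : (Fin (s + r) → ℕ) → M) :
    ∑ m ∈ orderedTuples (s + r) N with numPos m = s, F m =
      if s ≤ N then ∑ m ∈ orderedTuples s (N - s),
        F (Fin.append (fun i => m i + 1) (fun _ => 0)) else 0 := by
  have hfil : ∀ m ∈ (orderedTuples (s + r) N).filter (fun m => numPos m = s),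
      (∀ i : Fin s, m (Fin.castAdd r i) - 1 + 1 = m (Fin.castAdd r i)) ∧
      (∀ i : Fin r, m (Fin.natAdd s i) = 0) ∧
      ∑ i : Fin s, (m (Fin.castAdd r i) - 1) + s = N := by
    intro m hm
    obtain ⟨hm, hs⟩ := Finset.mem_filter.mp hm
    obtain ⟨hsum, hanti⟩ := mem_orderedTuples.mp hm
    have h1 : ∀ i : Fin s, m (Fin.castAdd r i) - 1 + 1 = m (Fin.castAdd r i) := by
      intro i
      have := (pos_iff_lt_numPos hanti (Fin.castAdd r i)).mpr (by rw [hs]; simp)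
      omega
    have h2 : ∀ i : Fin r, m (Fin.natAdd s i) = 0 := by
      intro i
      have := (pos_iff_lt_numPos hanti (Fin.natAdd s i)).not.mpr (by rw [hs]; simp)
      omega
    refine ⟨h1, h2, ?_⟩
    rw [← hsum, Fin.sum_univ_add, Finset.sum_eq_zero (fun i _ => h2 i), add_zero]
    conv_rhs => rw [← Finset.sum_congr rfl fun i _ => h1 i]
    rw [Finset.sum_add_distrib]
    simp
  split_ifs with hsN
  · symm
    refine Finset.sum_nbij' (fun m => Fin.append (fun i => m i + 1) (fun _ => 0))
      (fun m i => m (Fin.castAdd r i) - 1) ?_ ?_ ?_ ?_ ?_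
    · intro m hm
      obtain ⟨hsum, hanti⟩ := mem_orderedTuples.mp hm
      refine Finset.mem_filter.mpr ⟨mem_orderedTuples.mpr ⟨?_, antitone_append hanti⟩,
        numPos_append m⟩
      rw [Fin.sum_univ_add]
      simp [Finset.sum_add_distrib, hsum, hsN]
    · intro m hm
      obtain ⟨h1, h2, h3⟩ := hfil m hm
      refine mem_orderedTuples.mpr ⟨by omega, fun i j hij => ?_⟩
      have hanti := (mem_orderedTuples.mp (Finset.mem_filter.mp hm).1).2
      have hij' : Fin.castAdd r i ≤ Fin.castAdd r j := hij
      exact Nat.sub_le_sub_right (hanti hij') 1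
    · intro m _
      funext i
      simp
    · intro m hm
      obtain ⟨h1, h2, -⟩ := hfil m hm
      funext i
      refine Fin.addCases (fun i => ?_) (fun i => ?_) i
      · rw [Fin.append_left, h1]
      · rw [Fin.append_right, h2]
    · intro m _
      rfl
  · refine Finset.sum_eq_zero fun m hm => ?_
    have := (hfil m hm).2.2
    omega

/-- Raising all entries by one and appending `r` zeros multiplies the coefficient by the factor of
`a ^ r * z ^ s` in `add_pow_of_qCommute`. -/
lemma pbwCoeff_append {s r : ℕ} (m : Fin s → ℕ) :
    pbwCoeff (Fin.append (fun i => m i + 1) (fun _ : Fin r => 0)) =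
      gaussBinom (s + r) s * q ^ ((s : ℤ) * (s - 1)) * pbwCoeff m := by
  rw [pbwCoeff_split _ 0 (fun i => by simp) (fun i => by simp), gaussBinom_eq_qBinom]
  simp only [Fin.append_left, pbwCoeff_add_one, Nat.cast_zero, zero_mul, zero_add]
  ring

lemma reverse_prod_append {A : Type*} [Monoid A] {s r : ℕ} (x : ℕ → A) (m : Fin s → ℕ) :
    ((List.ofFn fun i => x (Fin.append (fun i => m i + 1) (fun _ : Fin r => 0) i)).reverse).prod =
      x 0 ^ r * ((List.ofFn fun i => x (m i + 1)).reverse).prod := by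
  have : (fun i => x (Fin.append (fun i => m i + 1) (fun _ : Fin r => 0) i)) =
      Fin.append (fun i => x (m i + 1)) (fun _ : Fin r => x 0) := by
    funext i
    refine Fin.addCases (fun i => ?_) (fun i => ?_) i <;> simp
  rw [this, List.ofFn_fin_append, List.reverse_append, List.prod_append, List.ofFn_const,
    List.reverse_replicate, List.prod_replicate]

/-! ### Expansion of the powers of a generating series -/

/-- Powers of generating series are reversed by passing to the opposite algebra; only the order of
the factors in the coefficients changes, since the variable is central. -/
lemma op_coeff_mk_pow {A : Type*} [Ring A] (y : ℕ → A) (n N : ℕ) :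
    MulOpposite.op (coeff N (mk y ^ n)) = coeff N (mk (fun k => MulOpposite.op (y k)) ^ n) := by
  induction n generalizing N with
  | zero =>
    rw [pow_zero, pow_zero, coeff_one, coeff_one]
    split_ifs <;> simp
  | succ n ih =>
    rw [pow_succ, pow_succ', coeff_mul, coeff_mul, Finset.op_sum,
      ← Finset.Nat.sum_antidiagonal_swap]
    refine Finset.sum_congr rfl fun p _ => ?_
    simp only [coeff_mk, MulOpposite.op_mul, Prod.fst_swap, Prod.snd_swap, ih]

variable {A : Type*} [Ring A] [Algebra Cq A]

/-- The quadratic relation says that the series `X = ∑ x_k u^k` and its shift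
`X' = ∑ x_{k+1} u^k` satisfy `X' X = q² X X'`: symmetrizing over `m + n = N` doubles both sides. -/
lemma mk_shift_mul_mk (x : ℕ → A)
    (hx : ∀ m n, x (m + 1) * x n + x (n + 1) * x m =
      q ^ (2 : ℤ) • (x m * x (n + 1) + x n * x (m + 1))) :
    (mk fun k => x (k + 1)) * mk x = q ^ (2 : ℤ) • (mk x * mk fun k => x (k + 1)) := by
  ext N
  rw [coeff_smul, coeff_mul, coeff_mul]
  simp only [coeff_mk]
  set S := ∑ p ∈ Finset.HasAntidiagonal.antidiagonal N, x (p.1 + 1) * x p.2 with hS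
  set T := ∑ p ∈ Finset.HasAntidiagonal.antidiagonal N, x p.1 * x (p.2 + 1) with hT
  have hS' : ∑ p ∈ Finset.HasAntidiagonal.antidiagonal N, x (p.2 + 1) * x p.1 = S :=
    Finset.Nat.sum_antidiagonal_swap (f := fun p : ℕ × ℕ => x (p.1 + 1) * x p.2)
  have hT' : ∑ p ∈ Finset.HasAntidiagonal.antidiagonal N, x p.2 * x (p.1 + 1) = T :=
    Finset.Nat.sum_antidiagonal_swap (f := fun p : ℕ × ℕ => x p.1 * x (p.2 + 1))
  have h2 : S + S = q ^ (2 : ℤ) • (T + T) := by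
    calc S + S = S + ∑ p ∈ Finset.HasAntidiagonal.antidiagonal N, x (p.2 + 1) * x p.1 := by rw [hS']
      _ = q ^ (2 : ℤ) • (T +
          ∑ p ∈ Finset.HasAntidiagonal.antidiagonal N, x p.2 * x (p.1 + 1)) := by
        rw [hS, hT, ← Finset.sum_add_distrib, ← Finset.sum_add_distrib, Finset.smul_sum]
        exact Finset.sum_congr rfl fun p _ => hx p.1 p.2
      _ = q ^ (2 : ℤ) • (T + T) := by rw [hT']
  rw [← two_smul Cq S, ← two_smul Cq T, smul_comm] at h2
  exact smul_right_injective A (two_ne_zero (α := Cq)) h2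

/-- The expansion of the powers of `∑ x_k u^k` in ordered monomials, in any algebra in which the
`x_k` satisfy the quadratic relation. -/
theorem coeff_mk_pow (N : ℕ) : ∀ (n : ℕ) (x : ℕ → A)
    (_ : ∀ m n, x (m + 1) * x n + x (n + 1) * x m =
      q ^ (2 : ℤ) • (x m * x (n + 1) + x n * x (m + 1))),
    coeff N (mk x ^ n) = ∑ m ∈ orderedTuples n N,
      pbwCoeff m • ((List.ofFn fun i => x (m i)).reverse).prod := by
  induction N using Nat.strong_induction_on with
  | _ N ih =>
    intro n x hx
    -- `X = x_0 + u X'`, and `u X'` `q²`-commutes with `X`.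
    set x' : ℕ → A := fun k => x (k + 1) with hx'
    have hdec : mk x = C (x 0) + mk x' * X := by
      have := eq_shift_mul_X_add_const (mk x)
      rw [this, add_comm]
      simp [hx']
    have hcomm : (mk x' * X) * (C (x 0) + mk x' * X) =
        q ^ (2 : ℤ) • ((C (x 0) + mk x' * X) * (mk x' * X)) := by
      rw [← hdec, mul_assoc, ← (commute_X (mk x)).eq, ← mul_assoc, mk_shift_mul_mk x hx,
        smul_mul_assoc, mul_assoc]
    rw [hdec, add_pow_of_qCommute _ _ hcomm, map_sum,
      ← Finset.sum_fiberwise_of_maps_to (t := Finset.range (n + 1)) (g := numPos)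
        (fun m _ => Finset.mem_range.mpr (Nat.lt_succ_iff.mpr (numPos_le m)))]
    refine Finset.sum_congr rfl fun s hs => ?_
    obtain ⟨r, rfl⟩ := Nat.exists_eq_add_of_le (Nat.lt_succ_iff.mp (Finset.mem_range.mp hs))
    rw [sum_orderedTuples_numPos, coeff_smul, (commute_X (mk x')).mul_pow, ← map_pow,
      Nat.add_sub_cancel_left, coeff_C_mul, coeff_mul_X_pow']
    split_ifs with hsN
    · have hcoeff : coeff (N - s) (mk x' ^ s) = ∑ m ∈ orderedTuples s (N - s),
          pbwCoeff m • ((List.ofFn fun i => x' (m i)).reverse).prod := by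
        -- For `s = 0` the degree does not drop, but the power is `1`.
        rcases Nat.eq_zero_or_pos s with rfl | hpos
        · rw [pow_zero, coeff_one, orderedTuples]
          by_cases hN : N = 0
          · subst hN
            simp [pbwCoeff, qFactorial_zero, Subsingleton.antitone]
          · obtain ⟨N, rfl⟩ := Nat.exists_eq_succ_of_ne_zero hN
            simp
        · exact ih (N - s) (by omega) s x' fun m n => hx (m + 1) (n + 1)
      rw [hcoeff, Finset.mul_sum, Finset.smul_sum]
      refine Finset.sum_congr rfl fun m _ => ?_
      rw [pbwCoeff_append, reverse_prod_append, mul_smul_comm, smul_smul]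
    · simp

/-! ### The relations of the Drinfeld generators -/

/-- The generators `x_m` satisfy the symmetrized form of their quadratic relation. -/
lemma x_relation (m n : ℤ) : x (m + 1) * x n + x (n + 1) * x m =
    q ^ (2 : ℤ) • (x m * x (n + 1) + x n * x (m + 1)) := by
  have h : toUq _ = toUq _ := RingQuot.mkAlgHom_rel Cq (Rel.x_x m n)
  simp only [map_sub, map_mul, map_smul] at h
  change x (m + 1) * x n - q ^ (2 : ℤ) • (x n * x (m + 1)) =
    q ^ (2 : ℤ) • (x m * x (n + 1)) - x (n + 1) * x m at h
  rw [smul_add]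
  exact (sub_eq_sub_iff_add_eq_add.mp h)

/-- The generators `y_m` satisfy the relation of the `x_m` in the opposite algebra. -/
lemma y_relation (m n : ℤ) : y n * y (m + 1) + y m * y (n + 1) =
    q ^ (2 : ℤ) • (y (n + 1) * y m + y (m + 1) * y n) := by
  have h : toUq _ = toUq _ := RingQuot.mkAlgHom_rel Cq (Rel.y_y m n)
  simp only [map_sub, map_mul, map_smul] at h
  change y (m + 1) * y n - q ^ (-2 : ℤ) • (y n * y (m + 1)) =
    q ^ (-2 : ℤ) • (y m * y (n + 1)) - y (n + 1) * y m at h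
  have h1 := sub_eq_sub_iff_add_eq_add.mp h
  rw [← smul_add] at h1
  rw [add_comm (y (n + 1) * y m), h1, smul_smul, ← zpow_add₀ q_ne_zero, add_comm]
  simp

end

end QuantumAffine

theorem theorem6 (n : ℕ) (hn : 1 ≤ n) :
    (QuantumAffine.X0plus ^ n = PowerSeries.mk fun N =>
      ∑ m ∈ QuantumAffine.orderedTuples n N,
        QuantumAffine.pbwCoeff m • QuantumAffine.xMonomial m) ∧
    (QuantumAffine.Y0plus ^ n = PowerSeries.mk fun N =>
      ∑ m ∈ QuantumAffine.orderedTuples n N,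
        QuantumAffine.pbwCoeff m • QuantumAffine.yMonomial m) ∧
    (∀ m : Fin n → ℕ, Antitone m →
      QuantumAffine.pbwCoeff m ∈
        Algebra.adjoin ℤ ({QuantumAffine.q, QuantumAffine.q⁻¹} : Set QuantumAffine.Cq)) ∧
    (∀ m : Fin n → ℕ, Antitone m →
      QuantumAffine.recCoeff n m = QuantumAffine.pbwCoeff m) := by
  refine ⟨?_, ?_, QuantumAffine.pbwCoeff_mem_adjoin n, QuantumAffine.recCoeff_eq_pbwCoeff n⟩
  · ext N
    rw [PowerSeries.coeff_mk]
    exact QuantumAffine.coeff_mk_pow N n _ fun a b => QuantumAffine.x_relation a b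
  -- In the opposite algebra the `y_k` satisfy the relation of the `x_k`.
  · ext N
    rw [PowerSeries.coeff_mk]
    apply MulOpposite.op_injective
    rw [QuantumAffine.Y0plus, QuantumAffine.op_coeff_mk_pow, QuantumAffine.coeff_mk_pow N n,
      Finset.op_sum]
    · refine Finset.sum_congr rfl fun m _ => ?_
      rw [MulOpposite.op_smul, QuantumAffine.yMonomial, MulOpposite.op_list_prod, List.map_ofFn]
      rfl
    · intro a b
      apply MulOpposite.unop_injective
      exact QuantumAffine.y_relation a b
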